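/- Let $M_1, M_2, Z_1, Z_2$ be i.i.d. $\mathcal N(0,1)$ random variables, and put $M = (M_1, M_2) \in \mathbb R^2$, $X = M_1 + Z_1$, $Y = M_2 + Z_2$, with joint law $P = P_{MXY}$, which is Gaussian. Write $I$ for mutual information. A bivariate partial information decomposition (PID) at $P$ is a quadruple of nonnegative reals $(UI_X, UI_Y, RI, SI)$ (the information about $M$ unique to $X$, unique to $Y$, redundant, synergistic) with $$I(M;(X,Y)) = UI_X + UI_Y + RI + SI,\qquad I(M;X) = UI_X + RI,\qquad I(M;Y) = UI_Y + RI.$$ The MMI-PID is the PID with $RI_{\mathrm{MMI}} = \min\{I(M;X), I(M;Y)\}$. The $\sim$-PID is the PID with $\widetilde{UI}_X = \min_{Q\in\Delta_P} I_Q(M;X\mid Y)$ and $\widetilde{UI}_Y = \min_{Q\in\Delta_P} I_Q(M;Y\mid X)$, where $\Delta_P$ is the set of all probability laws $Q$ of triples $(M,X,Y)$ with $Q_{MX} = P_{MX}$ and $Q_{MY} = P_{MY}$, and $I_Q(\cdot\,;\cdot\mid\cdot)$ is conditional mutual information under $Q$. Then, at this $P$, the $\sim$-PID and the MMI-PID both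 exist (in particular the minima are attained) and are unique, $I(M;X) = I(M;Y) > 0$, and: 1. $\widetilde{RI} = 0$, so that $\widetilde{UI}_X = I(M;X) > 0$ and $\widetilde{UI}_Y = I(M;Y) > 0$, and these two unique informations are equal; 2. $UI_{X,\mathrm{MMI}} = UI_{Y,\mathrm{MMI}} = 0$, and $RI_{\mathrm{MMI}} = I(M;X) = I(M;Y)$. Hence the $\sim$-PID of $P$ is not its MMI-PID: Barrett's theorem that for jointly Gaussian $(M,X,Y)$ with scalar $M$ the $\sim$-PID reduces to the MMI-PID fails for vector $M$. That is, it is not true that for every Gaussian law on $\mathbb R^2\times\mathbb R\times\mathbb R$ the $\sim$-PID is the MMI-PID. -/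

import Mathlib

open MeasureTheory ProbabilityTheory
open scoped NNReal ENNReal

noncomputable section

namespace PID

/-- Mutual information `I(A ; B)` of a joint law `J` of `(A, B)`: the Kullback-Leibler divergence
of `J` from the product of its marginals, with value in `[0, ∞]`. -/
def mutualInfo {α β : Type*} [MeasurableSpace α] [MeasurableSpace β] (J : Measure (α × β)) :
    ℝ≥0∞ :=
  InformationTheory.klDiv J (J.fst.prod J.snd)

/-- The `(M, X)`-marginal of a joint law of `(M, X, Y)`. -/
def margMX {𝓜 𝓧 𝓨 : Type*} [MeasurableSpace 𝓜] [MeasurableSpace 𝓧] [MeasurableSpace 𝓨]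
    (Q : Measure (𝓜 × 𝓧 × 𝓨)) : Measure (𝓜 × 𝓧) :=
  Q.map fun p => (p.1, p.2.1)

/-- The `(M, Y)`-marginal of a joint law of `(M, X, Y)`. -/
def margMY {𝓜 𝓧 𝓨 : Type*} [MeasurableSpace 𝓜] [MeasurableSpace 𝓧] [MeasurableSpace 𝓨]
    (Q : Measure (𝓜 × 𝓧 × 𝓨)) : Measure (𝓜 × 𝓨) :=
  Q.map fun p => (p.1, p.2.2)

/-- The `Y`-marginal of a joint law of `(M, X, Y)`. -/
def margY {𝓜 𝓧 𝓨 : Type*} [MeasurableSpace 𝓜] [MeasurableSpace 𝓧] [MeasurableSpace 𝓨]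
    (Q : Measure (𝓜 × 𝓧 × 𝓨)) : Measure 𝓨 :=
  Q.map fun p => p.2.2

/-- The law of `(M, Y, X)`, given the law of `(M, X, Y)`. -/
def swapXY {𝓜 𝓧 𝓨 : Type*} [MeasurableSpace 𝓜] [MeasurableSpace 𝓧] [MeasurableSpace 𝓨]
    (Q : Measure (𝓜 × 𝓧 × 𝓨)) : Measure (𝓜 × 𝓨 × 𝓧) :=
  Q.map fun p => (p.1, p.2.2, p.2.1)

/-- A regular conditional distribution `Q_{MX|Y}` of `(M, X)` given `Y`. -/
def condMX {𝓜 𝓧 𝓨 : Type*} [MeasurableSpace 𝓜] [MeasurableSpace 𝓧] [MeasurableSpace 𝓨]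
    [StandardBorelSpace 𝓜] [Nonempty 𝓜] [StandardBorelSpace 𝓧] [Nonempty 𝓧]
    (Q : Measure (𝓜 × 𝓧 × 𝓨)) [IsFiniteMeasure Q] : Kernel 𝓨 (𝓜 × 𝓧) :=
  condDistrib (fun p : 𝓜 × 𝓧 × 𝓨 => (p.1, p.2.1)) (fun p => p.2.2) Q

/-- Conditional mutual information
`I_Q(M ; X | Y) = D(Q_Y Q_{MX|Y} ‖ Q_Y (Q_{M|Y} × Q_{X|Y}))`, with value in `[0, ∞]`. -/
def condMutualInfo {𝓜 𝓧 𝓨 : Type*} [MeasurableSpace 𝓜] [MeasurableSpace 𝓧] [MeasurableSpace 𝓨]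
    [StandardBorelSpace 𝓜] [Nonempty 𝓜] [StandardBorelSpace 𝓧] [Nonempty 𝓧]
    (Q : Measure (𝓜 × 𝓧 × 𝓨)) [IsFiniteMeasure Q] : ℝ≥0∞ :=
  InformationTheory.klDiv (Measure.compProd (margY Q) (condMX Q))
    (Measure.compProd (margY Q) (Kernel.prod (Kernel.fst (condMX Q)) (Kernel.snd (condMX Q))))

/-- `Δ_P`: the probability laws `Q` of `(M, X, Y)` with `Q_{MX} = P_{MX}` and
`Q_{MY} = P_{MY}`. -/
def Delta {𝓜 𝓧 𝓨 : Type*} [MeasurableSpace 𝓜] [MeasurableSpace 𝓧] [MeasurableSpace 𝓨]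
    (P : Measure (𝓜 × 𝓧 × 𝓨)) : Set (ProbabilityMeasure (𝓜 × 𝓧 × 𝓨)) :=
  {Q | margMX (Q : Measure (𝓜 × 𝓧 × 𝓨)) = margMX P ∧
    margMY (Q : Measure (𝓜 × 𝓧 × 𝓨)) = margMY P}

/-- `u = min_{Q ∈ Δ_P} I_Q(M ; X | Y)`, the minimum being attained. -/
def IsTildeUI {𝓜 𝓧 𝓨 : Type*} [MeasurableSpace 𝓜] [MeasurableSpace 𝓧] [MeasurableSpace 𝓨]
    [StandardBorelSpace 𝓜] [Nonempty 𝓜] [StandardBorelSpace 𝓧] [Nonempty 𝓧]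
    (P : Measure (𝓜 × 𝓧 × 𝓨)) (u : ℝ≥0∞) : Prop :=
  IsLeast ((fun Q : ProbabilityMeasure (𝓜 × 𝓧 × 𝓨) =>
    condMutualInfo (Q : Measure (𝓜 × 𝓧 × 𝓨))) '' Delta P) u

/-- A bivariate partial information decomposition of `I(M ; (X, Y))` at the joint law `P` of
`(M, X, Y)`: nonnegative real numbers `UI_X`, `UI_Y`, `RI`, `SI` satisfying the three
decomposition equations. -/
structure Decomposition {𝓜 𝓧 𝓨 : Type*} [MeasurableSpace 𝓜] [MeasurableSpace 𝓧]
    [MeasurableSpace 𝓨] (P : Measure (𝓜 × 𝓧 × 𝓨)) where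
  /-- Information about `M` unique to `X`. -/
  uiX : ℝ≥0
  /-- Information about `M` unique to `Y`. -/
  uiY : ℝ≥0
  /-- Redundant information. -/
  ri : ℝ≥0
  /-- Synergistic information. -/
  si : ℝ≥0
  total_eq : mutualInfo P = (uiX : ℝ≥0∞) + uiY + ri + si
  infoX_eq : mutualInfo (margMX P) = (uiX : ℝ≥0∞) + ri
  infoY_eq : mutualInfo (margMY P) = (uiY : ℝ≥0∞) + ri

/-- The decomposition `d` is the MMI-PID: its redundancy is `min {I(M ; X), I(M ; Y)}`. -/
def Decomposition.IsMMI {𝓜 𝓧 𝓨 : Type*} [MeasurableSpace 𝓜] [MeasurableSpace 𝓧]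
    [MeasurableSpace 𝓨] {P : Measure (𝓜 × 𝓧 × 𝓨)} (d : Decomposition P) : Prop :=
  (d.ri : ℝ≥0∞) = min (mutualInfo (margMX P)) (mutualInfo (margMY P))

/-- The decomposition `d` is the `∼`-PID: its unique informations are
`min_{Q ∈ Δ_P} I_Q(M ; X | Y)` and `min_{Q ∈ Δ_P} I_Q(M ; Y | X)`. -/
def Decomposition.IsTilde {𝓜 𝓧 𝓨 : Type*} [MeasurableSpace 𝓜] [MeasurableSpace 𝓧]
    [MeasurableSpace 𝓨] [StandardBorelSpace 𝓜] [Nonempty 𝓜] [StandardBorelSpace 𝓧] [Nonempty 𝓧]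
    [StandardBorelSpace 𝓨] [Nonempty 𝓨]
    {P : Measure (𝓜 × 𝓧 × 𝓨)} (d : Decomposition P) : Prop :=
  IsTildeUI P d.uiX ∧ IsTildeUI (swapXY P) d.uiY

end PID

end

/-! The law `P` consists of two independent copies `(A, X)` and `(B, Y)` of one scalar Gaussian
channel with law `J`, bundled through `M = (A, B)`. Every `Q ∈ Δ_P` keeps the law of `(M, X)`, so
`(A, X)` still has law `J`; it keeps the law of `(M, Y)`, so `A` is still independent of `Y`. The
conditional law of `A` given `Y` is then constant, and mapping `(Y, M, X)` to `(A, X)` sends the two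
measures that define `I_Q(M ; X | Y)` to `J` and the product of its marginals. Data processing gives
`I(A ; X) ≤ I_Q(M ; X | Y)` (`mutualInfo_le_condMutualInfo`), and `P` itself attains the bound
(`condMutualInfo_indepLaw_le`).

Hence all of `I(M ; X) = I(A ; X)` is unique and the `∼`-redundancy is `0`. By symmetry `I(M ; Y)`
has the same value, which is therefore the MMI redundancy. The two decompositions differ because
this value is positive; they exist with finite entries because it is finite. Only these last two
facts use the Gaussian density and moments. -/

namespace InformationTheory

/-! ### Divergence of images and of product measures. -/

variable {α β : Type*} [MeasurableSpace α] [MeasurableSpace β]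

/-- The Kullback-Leibler divergence is invariant under maps with a measurable left inverse. -/
lemma klDiv_map_of_leftInverse (μ ν : Measure α) [IsFiniteMeasure μ] [IsFiniteMeasure ν]
    {f : α → β} {g : β → α} (hf : Measurable f) (hg : Measurable g)
    (hgf : Function.LeftInverse g f) : klDiv (μ.map f) (ν.map f) = klDiv μ ν := by
  refine le_antisymm (klDiv_map_le μ ν hf) ?_
  have h := klDiv_map_le (μ.map f) (ν.map f) hg
  rwa [Measure.map_map hg hf, Measure.map_map hg hf, hgf.comp_eq_id, Measure.map_id,
    Measure.map_id] at h

lemma klDiv_prod_left (μ ν : Measure α) [IsFiniteMeasure μ] [IsFiniteMeasure ν]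
    (τ : Measure β) [IsProbabilityMeasure τ] :
    klDiv (μ.prod τ) (ν.prod τ) = klDiv μ ν := by
  rw [← Measure.compProd_const, ← Measure.compProd_const, klDiv_compProd_left]

lemma klDiv_prod_right (μ ν : Measure α) [IsFiniteMeasure μ] [IsFiniteMeasure ν]
    (τ : Measure β) [IsProbabilityMeasure τ] :
    klDiv (τ.prod μ) (τ.prod ν) = klDiv μ ν := by
  rw [← Measure.prod_swap, ← Measure.prod_swap (μ := ν),
    klDiv_map_of_leftInverse _ _ measurable_swap measurable_swap Prod.swap_leftInverse,
    klDiv_prod_left]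

lemma klDiv_prod (μ₁ ν₁ : Measure α) [IsProbabilityMeasure μ₁] [IsProbabilityMeasure ν₁]
    (μ₂ ν₂ : Measure β) [IsProbabilityMeasure μ₂] [IsProbabilityMeasure ν₂] :
    klDiv (μ₁.prod μ₂) (ν₁.prod ν₂) = klDiv μ₁ ν₁ + klDiv μ₂ ν₂ := by
  rw [← Measure.compProd_const, ← Measure.compProd_const, klDiv_compProd_eq_add,
    Measure.compProd_const, Measure.compProd_const, klDiv_prod_right]

end InformationTheory

/-! ### Mutual information of two independent channels. -/

namespace PID

variable {α β 𝓜 𝓧 𝓨 : Type*} [MeasurableSpace α] [MeasurableSpace β] [MeasurableSpace 𝓜]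
  [MeasurableSpace 𝓧] [MeasurableSpace 𝓨]

/-- The law of `(e (A, B), X, Y)` when `(A, X)` and `(B, Y)` are independent with laws
`J₁` and `J₂`. -/
noncomputable def indepLaw (e : α × β ≃ᵐ 𝓜) (J₁ : Measure (α × 𝓧)) (J₂ : Measure (β × 𝓨)) :
    Measure (𝓜 × 𝓧 × 𝓨) :=
  (J₁.prod J₂).map fun p => (e (p.1.1, p.2.1), p.1.2, p.2.2)

instance (e : α × β ≃ᵐ 𝓜) (J₁ : Measure (α × 𝓧)) (J₂ : Measure (β × 𝓨))
    [IsProbabilityMeasure J₁] [IsProbabilityMeasure J₂] :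
    IsProbabilityMeasure (indepLaw e J₁ J₂) :=
  Measure.isProbabilityMeasure_map (by fun_prop)

instance (Q : Measure (𝓜 × 𝓧 × 𝓨)) [IsProbabilityMeasure Q] :
    IsProbabilityMeasure (swapXY Q) :=
  Measure.isProbabilityMeasure_map (by fun_prop)

instance (Q : Measure (𝓜 × 𝓧 × 𝓨)) [IsProbabilityMeasure Q] :
    IsProbabilityMeasure (margY Q) :=
  Measure.isProbabilityMeasure_map (by fun_prop)

lemma margMX_swapXY (Q : Measure (𝓜 × 𝓧 × 𝓨)) : margMX (swapXY Q) = margMY Q := by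
  rw [margMX, swapXY, Measure.map_map (by fun_prop) (by fun_prop)]
  rfl

section

variable (e : α × β ≃ᵐ 𝓜) (J₁ : Measure (α × 𝓧)) (J₂ : Measure (β × 𝓨))
  [IsProbabilityMeasure J₁] [IsProbabilityMeasure J₂]

/-- Since `e` is arbitrary, this family of laws is closed under exchanging the channels, so each
result about `X` also yields the one about `Y`. -/
lemma swapXY_indepLaw :
    swapXY (indepLaw e J₁ J₂) = indepLaw (MeasurableEquiv.prodComm.trans e) J₂ J₁ := by
  rw [swapXY, indepLaw, indepLaw, Measure.map_map (by fun_prop) (by fun_prop),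
    ← Measure.prod_swap (μ := J₁), Measure.map_map (by fun_prop) (by fun_prop)]
  rfl

/-- The image of an independent pair of laws under a map of both coordinates. -/
lemma map_prod_fst_snd {γ δ : Type*} [MeasurableSpace γ] [MeasurableSpace δ]
    {f : α × 𝓧 → γ} {g : β × 𝓨 → δ} (hf : Measurable f) (hg : Measurable g) :
    (J₁.prod J₂).map (fun p => (f p.1, g p.2)) = (J₁.map f).prod (J₂.map g) :=
  (Measure.map_prod_map J₁ J₂ hf hg).symm

omit [IsProbabilityMeasure J₁] [IsProbabilityMeasure J₂] in
lemma map_indepLaw {γ : Type*} [MeasurableSpace γ] {f : 𝓜 × 𝓧 × 𝓨 → γ} (hf : Measurable f) :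
    (indepLaw e J₁ J₂).map f =
      (J₁.prod J₂).map fun p => f (e (p.1.1, p.2.1), p.1.2, p.2.2) :=
  Measure.map_map hf (by fun_prop)

lemma margMX_indepLaw :
    margMX (indepLaw e J₁ J₂) =
      (J₁.prod J₂.fst).map fun p => (e (p.1.1, p.2), p.1.2) := by
  have h := map_prod_fst_snd J₁ J₂ measurable_id measurable_fst
  rw [Measure.map_id] at h
  rw [margMX, map_indepLaw _ _ _ (by fun_prop), Measure.fst, ← h,
    Measure.map_map (by fun_prop) (by fun_prop)]
  rfl

lemma fst_margMX_indepLaw :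
    (margMX (indepLaw e J₁ J₂)).fst = (J₁.fst.prod J₂.fst).map e := by
  rw [Measure.fst, margMX, Measure.map_map (by fun_prop) (by fun_prop),
    map_indepLaw _ _ _ (by fun_prop), Measure.fst, Measure.fst,
    ← map_prod_fst_snd _ _ (by fun_prop) (by fun_prop),
    Measure.map_map (by fun_prop) (by fun_prop)]
  rfl

omit [IsProbabilityMeasure J₁] in
lemma snd_margMX_indepLaw : (margMX (indepLaw e J₁ J₂)).snd = J₁.snd := by
  rw [Measure.snd, margMX, Measure.map_map (by fun_prop) (by fun_prop),
    map_indepLaw _ _ _ (by fun_prop), Measure.snd]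
  conv_rhs => rw [← Measure.fst_prod (μ := J₁) (ν := J₂), Measure.fst,
    Measure.map_map (by fun_prop) (by fun_prop)]
  rfl

/-- `I(M ; X) = I(A ; X)` when `M = e (A, B)` with `(A, X)` independent of `B`. -/
lemma mutualInfo_margMX_indepLaw :
    mutualInfo (margMX (indepLaw e J₁ J₂)) = mutualInfo J₁ := by
  -- The joint law and the product of marginals are images under the same invertible map, with a
  -- common factor `J₂.fst` that contributes no divergence.
  have h : ((J₁.fst.prod J₂.fst).map e).prod J₁.snd =
      ((J₁.fst.prod J₁.snd).prod J₂.fst).map fun p => (e (p.1.1, p.2), p.1.2) := by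
    refine Measure.ext_of_lintegral _ fun f hf => ?_
    rw [lintegral_prod _ hf.aemeasurable, lintegral_map hf.lintegral_prod_right' (by fun_prop),
      lintegral_map hf (by fun_prop), lintegral_prod _ (by fun_prop),
      lintegral_prod _ (by fun_prop), lintegral_prod _ (by fun_prop)]
    refine lintegral_congr fun a => ?_
    exact lintegral_lintegral_swap (by fun_prop)
  rw [mutualInfo, fst_margMX_indepLaw, snd_margMX_indepLaw, h, margMX_indepLaw,
    InformationTheory.klDiv_map_of_leftInverse (g := fun p : 𝓜 × 𝓧 =>
      (((e.symm p.1).1, p.2), (e.symm p.1).2)) _ _ (by fun_prop) (by fun_prop)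
      (fun p => by simp), InformationTheory.klDiv_prod_left, mutualInfo]

/-- `I(M ; (X, Y)) = I(A ; X) + I(B ; Y)` when `M = e (A, B)` with `(A, X)` independent of
`(B, Y)`. -/
lemma mutualInfo_indepLaw :
    mutualInfo (indepLaw e J₁ J₂) = mutualInfo J₁ + mutualInfo J₂ := by
  have hfst : (indepLaw e J₁ J₂).fst = (J₁.fst.prod J₂.fst).map e := by
    rw [← fst_margMX_indepLaw, Measure.fst, Measure.fst, margMX,
      Measure.map_map (by fun_prop) (by fun_prop)]
    rfl
  have hsnd : (indepLaw e J₁ J₂).snd = J₁.snd.prod J₂.snd := by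
    rw [Measure.snd, map_indepLaw _ _ _ (by fun_prop), Measure.snd, Measure.snd,
      ← map_prod_fst_snd _ _ (by fun_prop) (by fun_prop)]
  have h : ((J₁.fst.prod J₂.fst).map e).prod (J₁.snd.prod J₂.snd) =
      indepLaw e (J₁.fst.prod J₁.snd) (J₂.fst.prod J₂.snd) := by
    refine Measure.ext_of_lintegral _ fun f hf => ?_
    rw [indepLaw, lintegral_prod _ hf.aemeasurable,
      lintegral_map hf.lintegral_prod_right' (by fun_prop),
      lintegral_map hf (by fun_prop), lintegral_prod _ (by fun_prop),
      lintegral_prod _ (by fun_prop), lintegral_prod _ (by fun_prop)]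
    refine lintegral_congr fun a => ?_
    have h1 (b : β) : ∫⁻ p, f (e (a, b), p) ∂(J₁.snd.prod J₂.snd) =
        ∫⁻ x, ∫⁻ y, f (e (a, b), x, y) ∂J₂.snd ∂J₁.snd := lintegral_prod _ (by fun_prop)
    have h2 (x : 𝓧) : ∫⁻ p : β × 𝓨, f (e (a, p.1), x, p.2) ∂(J₂.fst.prod J₂.snd) =
        ∫⁻ b, ∫⁻ y, f (e (a, b), x, y) ∂J₂.snd ∂J₂.fst := lintegral_prod _ (by fun_prop)
    simp only [h1, h2]
    exact lintegral_lintegral_swap (by fun_prop)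
  rw [mutualInfo, hfst, hsnd, h, indepLaw, indepLaw,
    InformationTheory.klDiv_map_of_leftInverse (g := fun p : 𝓜 × 𝓧 × 𝓨 =>
      (((e.symm p.1).1, p.2.1), ((e.symm p.1).2, p.2.2))) _ _ (by fun_prop) (by fun_prop)
      (fun p => by simp), InformationTheory.klDiv_prod, mutualInfo, mutualInfo]

end

end PID

/-! ### Unique information: lower bound and attainment. -/

namespace PID

variable {α β 𝓜 𝓧 𝓨 : Type*} [MeasurableSpace α] [MeasurableSpace β] [MeasurableSpace 𝓜]
  [MeasurableSpace 𝓧] [MeasurableSpace 𝓨]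
  [StandardBorelSpace 𝓜] [Nonempty 𝓜] [StandardBorelSpace 𝓧] [Nonempty 𝓧]

instance (Q : Measure (𝓜 × 𝓧 × 𝓨)) [IsFiniteMeasure Q] : IsMarkovKernel (condMX Q) := by
  unfold condMX; infer_instance

lemma margY_compProd_condMX (Q : Measure (𝓜 × 𝓧 × 𝓨)) [IsFiniteMeasure Q] :
    margY Q ⊗ₘ condMX Q = Q.map fun p => (p.2.2, p.1, p.2.1) :=
  compProd_map_condDistrib (by fun_prop)

lemma margY_compProd_fst_condMX (Q : Measure (𝓜 × 𝓧 × 𝓨)) [IsProbabilityMeasure Q] :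
    margY Q ⊗ₘ (condMX Q).fst = Q.map fun p => (p.2.2, p.1) := by
  rw [Kernel.fst_eq, Measure.compProd_map measurable_fst, margY_compProd_condMX,
    Measure.map_map (by fun_prop) (by fun_prop)]
  rfl

lemma margY_compProd_snd_condMX (Q : Measure (𝓜 × 𝓧 × 𝓨)) [IsProbabilityMeasure Q] :
    margY Q ⊗ₘ (condMX Q).snd = Q.map fun p => (p.2.2, p.2.1) := by
  rw [Kernel.snd_eq, Measure.compProd_map measurable_snd, margY_compProd_condMX,
    Measure.map_map (by fun_prop) (by fun_prop)]
  rfl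

/-- If `a M` is independent of `Y`, then `I(a M ; X) ≤ I(M ; X | Y)`. -/
lemma mutualInfo_le_condMutualInfo [StandardBorelSpace α]
    (Q : Measure (𝓜 × 𝓧 × 𝓨)) [IsProbabilityMeasure Q] {a : 𝓜 → α} (ha : Measurable a)
    (hindep : IndepFun (fun p => p.2.2) (fun p => a p.1) Q) :
    mutualInfo (Q.map fun p => (a p.1, p.2.1)) ≤ condMutualInfo Q := by
  set ρ := margY Q
  set κ := condMX Q
  set J := Q.map fun p => (a p.1, p.2.1)
  have : IsProbabilityMeasure J := Measure.isProbabilityMeasure_map (by fun_prop)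
  have hJfst : J.fst = Q.map fun p => a p.1 := Measure.fst_map_prodMk (by fun_prop)
  have hJsnd : J.snd = Q.map fun p => p.2.1 := Measure.snd_map_prodMk (by fun_prop)
  -- Independence from `Y`, read on kernels: the conditional law of `a M` is almost surely constant.
  have hconst : (κ.fst.map a : Kernel 𝓨 α) =ᵐ[ρ] Kernel.const 𝓨 J.fst := by
    refine Kernel.ae_eq_of_compProd_eq ?_
    rw [Measure.compProd_map ha, margY_compProd_fst_condMX,
      Measure.map_map (by fun_prop) (by fun_prop), Measure.compProd_const, hJfst]
    exact (indepFun_iff_map_prod_eq_prod_map_map (by fun_prop) (by fun_prop)).1 hindep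
  have hsnd : (ρ ⊗ₘ κ.snd).snd = J.snd := by
    rw [margY_compProd_snd_condMX, Measure.snd_map_prodMk (by fun_prop), hJsnd]
  have hg : Measurable fun q : 𝓨 × 𝓜 × 𝓧 => (a q.2.1, q.2.2) := by fun_prop
  have h1 : (ρ ⊗ₘ κ).map (fun q => (a q.2.1, q.2.2)) = J := by
    rw [margY_compProd_condMX, Measure.map_map hg (by fun_prop)]
    rfl
  -- The constant factor leaves the integral over `Y`; what remains averages `Q_{X|Y}` to the law of
  -- `X`.
  have h2 : (ρ ⊗ₘ (κ.fst ×ₖ κ.snd)).map (fun q => (a q.2.1, q.2.2)) = J.fst.prod J.snd := by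
    refine (Measure.prod_eq fun s t hs ht => ?_).symm
    rw [Measure.map_apply hg (hs.prod ht), Measure.compProd_apply (hg (hs.prod ht))]
    have hpre (y : 𝓨) : Prod.mk y ⁻¹' ((fun q : 𝓨 × 𝓜 × 𝓧 => (a q.2.1, q.2.2)) ⁻¹' s ×ˢ t) =
        (a ⁻¹' s) ×ˢ t := rfl
    simp only [hpre, Kernel.prod_apply_prod]
    have hae : ∀ᵐ y ∂ρ, κ.fst y (a ⁻¹' s) * κ.snd y t = J.fst s * κ.snd y t := by
      filter_upwards [hconst] with y hy
      rw [← Measure.map_apply ha hs, ← Kernel.map_apply _ ha, hy, Kernel.const_apply]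
    rw [lintegral_congr_ae hae, lintegral_const_mul _ (Kernel.measurable_coe _ ht), ← hsnd,
      Measure.snd_apply ht, Measure.compProd_apply (measurable_snd ht)]
    rfl
  calc mutualInfo J = InformationTheory.klDiv ((ρ ⊗ₘ κ).map fun q => (a q.2.1, q.2.2))
        ((ρ ⊗ₘ (κ.fst ×ₖ κ.snd)).map fun q => (a q.2.1, q.2.2)) := by rw [h1, h2, mutualInfo]
    _ ≤ condMutualInfo Q := InformationTheory.klDiv_map_le _ _ hg

variable (e : α × β ≃ᵐ 𝓜) (J₁ : Measure (α × 𝓧)) (J₂ : Measure (β × 𝓨))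
  [IsProbabilityMeasure J₁] [IsProbabilityMeasure J₂]

/-- `I(M ; X | Y) ≤ I(A ; X)` when `M = e (A, B)` with `(A, X)` independent of `(B, Y)`. -/
lemma condMutualInfo_indepLaw_le :
    condMutualInfo (indepLaw e J₁ J₂) ≤ mutualInfo J₁ := by
  set P := indepLaw e J₁ J₂ with hP
  set ρ := margY P
  set κ := condMX P
  set f : (α × 𝓧) × (β × 𝓨) → 𝓨 × 𝓜 × 𝓧 := fun p => (p.2.2, e (p.1.1, p.2.1), p.1.2)
  have hf : Measurable f := by fun_prop
  have hρ : ρ = J₂.snd := by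
    have h := snd_margMX_indepLaw (MeasurableEquiv.prodComm.trans e) J₂ J₁
    rw [← swapXY_indepLaw, margMX_swapXY, Measure.snd, margMY,
      Measure.map_map (by fun_prop) (by fun_prop)] at h
    exact h
  have h1 : ρ ⊗ₘ κ = (J₁.prod J₂).map f := by
    rw [margY_compProd_condMX, hP, map_indepLaw _ _ _ (by fun_prop)]
  have hconst : κ.snd =ᵐ[ρ] Kernel.const 𝓨 J₁.snd := by
    refine Kernel.ae_eq_of_compProd_eq ?_
    rw [margY_compProd_snd_condMX, Measure.compProd_const, hρ, hP,
      map_indepLaw _ _ _ (by fun_prop), ← Measure.prod_swap, Measure.snd, Measure.snd,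
      ← map_prod_fst_snd _ _ (by fun_prop) (by fun_prop),
      Measure.map_map (by fun_prop) (by fun_prop)]
    rfl
  have hfst : ρ ⊗ₘ κ.fst = (J₁.fst.prod J₂).map fun p => (p.2.2, e (p.1, p.2.1)) := by
    have h := map_prod_fst_snd J₁ J₂ measurable_fst measurable_id
    rw [Measure.map_id] at h
    rw [margY_compProd_fst_condMX, hP, map_indepLaw _ _ _ (by fun_prop), Measure.fst, ← h,
      Measure.map_map (by fun_prop) (by fun_prop)]
    rfl
  -- As `X` is independent of `Y`, the reference measure is an image under the same `f` as the joint
  -- law, again with common factor `J₂`.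
  have h2 : ρ ⊗ₘ (κ.fst ×ₖ κ.snd) = ((J₁.fst.prod J₁.snd).prod J₂).map f := by
    have hprod : (κ.fst ×ₖ κ.snd : Kernel 𝓨 (𝓜 × 𝓧)) =ᵐ[ρ]
        (κ.fst ×ₖ Kernel.const 𝓨 J₁.snd : Kernel 𝓨 (𝓜 × 𝓧)) := by
      filter_upwards [hconst] with y hy
      rw [Kernel.prod_apply, Kernel.prod_apply, hy]
    rw [Measure.compProd_congr hprod]
    refine Measure.ext_of_lintegral _ fun φ hφ => ?_
    rw [Measure.lintegral_compProd hφ, lintegral_map hφ hf, lintegral_prod _ (by fun_prop),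
      lintegral_prod _ (by fun_prop)]
    have hin (y : 𝓨) : ∫⁻ q, φ (y, q) ∂((κ.fst ×ₖ Kernel.const 𝓨 J₁.snd) y) =
        ∫⁻ m, ∫⁻ x, φ (y, m, x) ∂J₁.snd ∂(κ.fst y) := by
      rw [Kernel.lintegral_prod _ _ _ (by fun_prop)]
      simp only [Kernel.const_apply]
    have hmeas : Measurable fun q : 𝓨 × 𝓜 => ∫⁻ x, φ (q.1, q.2, x) ∂J₁.snd :=
      Measurable.lintegral_prod_right' (f := fun q : (𝓨 × 𝓜) × 𝓧 => φ (q.1.1, q.1.2, q.2))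
        (by fun_prop)
    simp only [hin]
    rw [← Measure.lintegral_compProd hmeas, hfst, lintegral_map hmeas (by fun_prop),
      lintegral_prod _ (by fun_prop)]
    refine lintegral_congr fun a => ?_
    exact lintegral_lintegral_swap (by fun_prop)
  calc condMutualInfo P
      = InformationTheory.klDiv ((J₁.prod J₂).map f) (((J₁.fst.prod J₁.snd).prod J₂).map f) := by
        rw [← h1, ← h2, condMutualInfo]
    _ ≤ InformationTheory.klDiv (J₁.prod J₂) ((J₁.fst.prod J₁.snd).prod J₂) :=
        InformationTheory.klDiv_map_le _ _ hf
    _ = mutualInfo J₁ := InformationTheory.klDiv_prod_left _ _ _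

/-- The information of `X` about `M` is entirely unique when `M = e (A, B)` with `(A, X)`
independent of `(B, Y)`. -/
lemma isTildeUI_indepLaw [StandardBorelSpace α] :
    IsTildeUI (indepLaw e J₁ J₂) (mutualInfo J₁) := by
  -- Each marginal constraint supplies one input: `hX` the law of `(A, X)`, `hY` the independence of
  -- `A` and `Y`.
  have hlower (Q : Measure (𝓜 × 𝓧 × 𝓨)) [IsProbabilityMeasure Q]
      (hX : margMX Q = margMX (indepLaw e J₁ J₂)) (hY : margMY Q = margMY (indepLaw e J₁ J₂)) :
      mutualInfo J₁ ≤ condMutualInfo Q := by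
    have ha : Measurable fun m => (e.symm m).1 := by fun_prop
    have hJ : Q.map (fun p => ((e.symm p.1).1, p.2.1)) = J₁ := by
      have h : Q.map (fun p => ((e.symm p.1).1, p.2.1)) =
          (margMX Q).map fun q => ((e.symm q.1).1, q.2) := by
        rw [margMX, Measure.map_map (by fun_prop) (by fun_prop)]
        rfl
      rw [h, hX, margMX_indepLaw, Measure.map_map (by fun_prop) (by fun_prop)]
      conv_rhs => rw [← Measure.fst_prod (μ := J₁) (ν := J₂.fst), Measure.fst]
      congr 1
      ext p <;> simp
    have hindep : IndepFun (fun p => p.2.2) (fun p => (e.symm p.1).1) Q := by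
      have h : Q.map (fun p => (p.2.2, (e.symm p.1).1)) = J₂.snd.prod J₁.fst := by
        have hQ : Q.map (fun p => (p.2.2, (e.symm p.1).1)) =
            (margMY Q).map fun q => (q.2, (e.symm q.1).1) := by
          rw [margMY, Measure.map_map (by fun_prop) (by fun_prop)]
          rfl
        rw [hQ, hY, margMY, Measure.map_map (by fun_prop) (by fun_prop),
          map_indepLaw _ _ _ (by fun_prop), ← Measure.prod_swap, Measure.snd, Measure.fst,
          ← map_prod_fst_snd _ _ (by fun_prop) (by fun_prop),
          Measure.map_map (by fun_prop) (by fun_prop)]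
        congr 1
        ext p <;> simp
      have h1 : Q.map (fun p => p.2.2) = J₂.snd := by
        rw [← Measure.fst_map_prodMk (X := fun p : 𝓜 × 𝓧 × 𝓨 => p.2.2)
          (Y := fun p => (e.symm p.1).1) (by fun_prop), h, Measure.fst_prod]
      have h2 : Q.map (fun p => (e.symm p.1).1) = J₁.fst := by
        rw [← Measure.snd_map_prodMk (X := fun p : 𝓜 × 𝓧 × 𝓨 => p.2.2)
          (Y := fun p => (e.symm p.1).1) (by fun_prop), h, Measure.snd_prod]
      rw [indepFun_iff_map_prod_eq_prod_map_map (by fun_prop) (by fun_prop), h, h1, h2]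
    calc mutualInfo J₁ = mutualInfo (Q.map fun p => ((e.symm p.1).1, p.2.1)) := by rw [hJ]
      _ ≤ condMutualInfo Q := mutualInfo_le_condMutualInfo Q ha hindep
  refine ⟨⟨⟨indepLaw e J₁ J₂, inferInstance⟩, ⟨rfl, rfl⟩, ?_⟩, ?_⟩
  · exact le_antisymm (condMutualInfo_indepLaw_le e J₁ J₂) (hlower (indepLaw e J₁ J₂) rfl rfl)
  · rintro _ ⟨Q, ⟨hX, hY⟩, rfl⟩
    exact hlower _ hX hY

end PID

/-! ### The scalar Gaussian channel: `0 < I(A ; X) < ∞`. -/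

namespace PID

/-- The joint law of a standard Gaussian signal and its sum with independent standard Gaussian
noise. -/
noncomputable def gaussianChannel : Measure (ℝ × ℝ) :=
  ((gaussianReal 0 1).prod (gaussianReal 0 1)).map fun p => (p.1, p.1 + p.2)

instance : IsProbabilityMeasure gaussianChannel :=
  Measure.isProbabilityMeasure_map (by fun_prop)

lemma fst_gaussianChannel : gaussianChannel.fst = gaussianReal 0 1 := by
  rw [gaussianChannel, Measure.fst_map_prodMk (by fun_prop)]
  exact Measure.fst_prod

lemma snd_gaussianChannel : gaussianChannel.snd = gaussianReal 0 2 := by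
  rw [gaussianChannel, Measure.snd_map_prodMk (by fun_prop), ← Measure.conv,
    gaussianReal_conv_gaussianReal, zero_add, one_add_one_eq_two]

/-- Given the signal `m`, the output is `N(m, 1)`, while its marginal is `N(0, 2)`. The density is
the ratio of the two, after translating the noise variable by `m`. -/
lemma gaussianChannel_eq_withDensity :
    gaussianChannel = (gaussianChannel.fst.prod gaussianChannel.snd).withDensity
      fun p => gaussianPDF 0 1 (p.2 - p.1) / gaussianPDF 0 2 p.2 := by
  have h1 : Measurable (gaussianPDF 0 1) := measurable_gaussianPDF 0 1
  have h2 : Measurable (gaussianPDF 0 2) := measurable_gaussianPDF 0 2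
  rw [fst_gaussianChannel, snd_gaussianChannel, gaussianChannel]
  refine Measure.ext_of_lintegral _ fun f hf => ?_
  rw [lintegral_withDensity_eq_lintegral_mul _ (by fun_prop) hf, lintegral_map hf (by fun_prop),
    lintegral_prod _ (by fun_prop), lintegral_prod _ (by fun_prop)]
  refine lintegral_congr fun m => ?_
  rw [gaussianReal_of_var_ne_zero 0 one_ne_zero, gaussianReal_of_var_ne_zero 0 two_ne_zero,
    lintegral_withDensity_eq_lintegral_mul _ h1 (by fun_prop),
    lintegral_withDensity_eq_lintegral_mul _ h2 (by simp only [Pi.mul_apply]; fun_prop),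
    ← lintegral_sub_right_eq_self _ m]
  refine lintegral_congr fun x => ?_
  simp only [Pi.mul_apply, add_sub_cancel]
  rw [← mul_assoc, ENNReal.mul_div_cancel (gaussianPDF_pos 0 two_ne_zero x).ne'
    gaussianPDF_ne_top]

lemma log_gaussianPDFReal (m : ℝ) {v : ℝ≥0} (hv : v ≠ 0) (x : ℝ) :
    Real.log (gaussianPDFReal m v x) =
      Real.log (√(2 * Real.pi * v))⁻¹ - (x - m) ^ 2 / (2 * v) := by
  have : (0 : ℝ) < v := by positivity
  rw [gaussianPDFReal, Real.log_mul (by positivity) (Real.exp_ne_zero _), Real.log_exp]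
  ring

/-- The log-likelihood ratio is a quadratic polynomial, integrable because Gaussians have second
moments. -/
lemma mutualInfo_gaussianChannel_ne_top : mutualInfo gaussianChannel ≠ ∞ := by
  set ν := gaussianChannel.fst.prod gaussianChannel.snd
  set h : ℝ × ℝ → ℝ≥0∞ := fun p => gaussianPDF 0 1 (p.2 - p.1) / gaussianPDF 0 2 p.2
  have h1 : Measurable (gaussianPDF 0 1) := measurable_gaussianPDF 0 1
  have h2 : Measurable (gaussianPDF 0 2) := measurable_gaussianPDF 0 2
  have hmeas : Measurable h := by fun_prop
  have hac : gaussianChannel ≪ ν := by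
    rw [gaussianChannel_eq_withDensity]
    exact withDensity_absolutelyContinuous _ _
  refine InformationTheory.klDiv_ne_top hac ?_
  have hrn : gaussianChannel.rnDeriv ν =ᵐ[ν] h := by
    conv_lhs => rw [gaussianChannel_eq_withDensity]
    exact Measure.rnDeriv_withDensity ν hmeas
  set c : ℝ := Real.log (√(2 * Real.pi * (1 : ℝ≥0)))⁻¹ - Real.log (√(2 * Real.pi * (2 : ℝ≥0)))⁻¹
  have hllr : llr gaussianChannel ν =ᵐ[gaussianChannel]
      fun p => c - (p.2 - p.1) ^ 2 / 2 + p.2 ^ 2 / 4 := by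
    filter_upwards [hac.ae_le hrn] with p hp
    simp only [llr_def]
    rw [hp, ENNReal.toReal_div, toReal_gaussianPDF, toReal_gaussianPDF,
      Real.log_div (gaussianPDFReal_pos _ _ _ one_ne_zero).ne'
        (gaussianPDFReal_pos _ _ _ two_ne_zero).ne',
      log_gaussianPDFReal 0 one_ne_zero, log_gaussianPDFReal 0 two_ne_zero]
    simp only [c, NNReal.coe_one, NNReal.coe_ofNat]
    ring
  rw [integrable_congr hllr, gaussianChannel,
    integrable_map_measure (by fun_prop) (by fun_prop)]
  have hL : MemLp (fun x : ℝ => x) 2 (gaussianReal 0 1) := memLp_id_gaussianReal 2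
  have hm : MemLp (fun p : ℝ × ℝ => p.1) 2 ((gaussianReal 0 1).prod (gaussianReal 0 1)) :=
    hL.comp_fst _
  have hz : MemLp (fun p : ℝ × ℝ => p.2) 2 ((gaussianReal 0 1).prod (gaussianReal 0 1)) :=
    hL.comp_snd _
  refine (((integrable_const c).sub (hz.integrable_sq.div_const 2)).add
    ((hm.add hz).integrable_sq.div_const 4)).congr (ae_of_all _ fun p => ?_)
  simp

/-- Zero divergence would make signal and output independent, hence uncorrelated, but `E[A (A + Z)]
= E[A²] = 1`. -/
lemma mutualInfo_gaussianChannel_pos : 0 < mutualInfo gaussianChannel := by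
  rw [pos_iff_ne_zero, mutualInfo, Ne, InformationTheory.klDiv_eq_zero_iff]
  intro h
  have hL : MemLp (fun x : ℝ => x) 2 (gaussianReal 0 1) := memLp_id_gaussianReal 2
  have hm : MemLp (fun p : ℝ × ℝ => p.1) 2 ((gaussianReal 0 1).prod (gaussianReal 0 1)) :=
    hL.comp_fst _
  have hz : MemLp (fun p : ℝ × ℝ => p.2) 2 ((gaussianReal 0 1).prod (gaussianReal 0 1)) :=
    hL.comp_snd _
  have hsq : ∫ x, x ^ 2 ∂(gaussianReal 0 1) = 1 := by
    have hv := variance_of_integral_eq_zero (X := id) (μ := gaussianReal 0 1) (by fun_prop)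
      integral_id_gaussianReal
    rw [variance_id_gaussianReal] at hv
    simpa using hv.symm
  have h0 : ∫ p, p.1 * p.2 ∂gaussianChannel = 0 := by
    rw [h, integral_prod_mul (fun x => x) (fun x => x), fst_gaussianChannel,
      integral_id_gaussianReal, zero_mul]
  have h1 : ∫ p, p.1 * p.2 ∂gaussianChannel = 1 := by
    rw [gaussianChannel, integral_map (by fun_prop) (by fun_prop)]
    simp only [mul_add, ← pow_two]
    have hmz : Integrable (fun p : ℝ × ℝ => p.1 * p.2)
        ((gaussianReal 0 1).prod (gaussianReal 0 1)) := hm.integrable_mul hz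
    rw [integral_add hm.integrable_sq hmz, integral_prod_mul (fun x => x) (fun x => x), integral_id_gaussianReal, zero_mul, add_zero,
      integral_fun_fst (fun x => x ^ 2), hsq]
    simp
  linarith

end PID

/-! ### Uniqueness of decompositions and the counterexample. -/

namespace PID

section Existence

variable {𝓜 𝓧 𝓨 : Type*} [MeasurableSpace 𝓜] [MeasurableSpace 𝓧] [MeasurableSpace 𝓨]

/-- A decomposition is determined by its unique informations. -/
lemma Decomposition.ext_of_uiX_uiY {P : Measure (𝓜 × 𝓧 × 𝓨)} {d d' : Decomposition P}
    (hX : d.uiX = d'.uiX) (hY : d.uiY = d'.uiY) : d = d' := by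
  obtain ⟨x, y, r, s, h1, h2, h3⟩ := d
  obtain ⟨x', y', r', s', h1', h2', h3'⟩ := d'
  obtain rfl : x = x' := hX
  obtain rfl : y = y' := hY
  rw [h2] at h2'
  rw [h1] at h1'
  norm_cast at h1' h2'
  obtain rfl : r = r' := add_left_cancel h2'
  obtain rfl : s = s' := add_left_cancel h1'
  rfl

/-- A decomposition is determined by its redundancy. -/
lemma Decomposition.ext_of_ri {P : Measure (𝓜 × 𝓧 × 𝓨)} {d d' : Decomposition P}
    (h : d.ri = d'.ri) : d = d' := by
  have hX := d.infoX_eq.symm.trans d'.infoX_eq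
  have hY := d.infoY_eq.symm.trans d'.infoY_eq
  norm_cast at hX hY
  rw [h] at hX hY
  exact Decomposition.ext_of_uiX_uiY (add_right_cancel hX) (add_right_cancel hY)

end Existence

/-- The pair `(a, b)` as a vector of the Euclidean plane. -/
noncomputable def planeEquiv : ℝ × ℝ ≃ᵐ EuclideanSpace ℝ (Fin 2) :=
  MeasurableEquiv.finTwoArrow.symm.trans (MeasurableEquiv.toLp 2 (Fin 2 → ℝ))

lemma planeEquiv_apply (p : ℝ × ℝ) : planeEquiv p = !₂[p.1, p.2] := by
  ext i
  fin_cases i <;> rfl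

end PID

theorem mainTheorem6 {Ω : Type*} [MeasurableSpace Ω] (μ : Measure Ω) [IsProbabilityMeasure μ]
    (M₁ M₂ Z₁ Z₂ X Y : Ω → ℝ) (M : Ω → EuclideanSpace ℝ (Fin 2))
    (P : Measure (EuclideanSpace ℝ (Fin 2) × ℝ × ℝ))
    (hM₁ : HasLaw M₁ (gaussianReal 0 1) μ) (hM₂ : HasLaw M₂ (gaussianReal 0 1) μ)
    (hZ₁ : HasLaw Z₁ (gaussianReal 0 1) μ) (hZ₂ : HasLaw Z₂ (gaussianReal 0 1) μ)
    (hindep : iIndepFun ![M₁, M₂, Z₁, Z₂] μ)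
    (hM : M = fun ω => !₂[M₁ ω, M₂ ω])
    (hX : X = fun ω => M₁ ω + Z₁ ω) (hY : Y = fun ω => M₂ ω + Z₂ ω)
    (hP : P = μ.map fun ω => (M ω, X ω, Y ω)) :
    -- the example is jointly Gaussian, and both decompositions exist and are unique
    HasGaussianLaw (fun ω => (M ω, X ω, Y ω)) μ ∧
    (∃! t : PID.Decomposition P, t.IsTilde) ∧
    (∃! m : PID.Decomposition P, m.IsMMI) ∧
    -- the two mutual informations agree and are positive
    PID.mutualInfo (PID.margMX P) = PID.mutualInfo (PID.margMY P) ∧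
    0 < PID.mutualInfo (PID.margMX P) ∧
    -- the `∼`-PID: no redundancy, all the information is unique
    (∀ t : PID.Decomposition P, t.IsTilde →
      t.ri = 0 ∧ 0 < t.uiX ∧ 0 < t.uiY ∧ t.uiX = t.uiY ∧
      (t.uiX : ℝ≥0∞) = PID.mutualInfo (PID.margMX P) ∧
      (t.uiY : ℝ≥0∞) = PID.mutualInfo (PID.margMY P)) ∧
    -- the MMI-PID: no unique information, all the information is redundant
    (∀ m : PID.Decomposition P, m.IsMMI →
      m.uiX = 0 ∧ m.uiY = 0 ∧
      (m.ri : ℝ≥0∞) = PID.mutualInfo (PID.margMX P) ∧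
      (m.ri : ℝ≥0∞) = PID.mutualInfo (PID.margMY P)) ∧
    -- hence the two differ: the reduction fails for this vector message, so in general
    (∀ t : PID.Decomposition P, t.IsTilde → ¬ t.IsMMI) ∧
    ¬ (∀ R : Measure (EuclideanSpace ℝ (Fin 2) × ℝ × ℝ), IsGaussian R →
        ∀ t : PID.Decomposition R, t.IsTilde → t.IsMMI) := by
  
  set J := PID.gaussianChannel
  set e := PID.planeEquiv
  have hW (i : Fin 4) : HasLaw (![M₁, M₂, Z₁, Z₂] i) (gaussianReal 0 1) μ := by
    fin_cases i <;> assumption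
  have hgauss : HasGaussianLaw (fun ω => (M ω, X ω, Y ω)) μ := by
    have h := hindep.hasGaussianLaw fun i => ⟨by rw [(hW i).map_eq]; infer_instance⟩
    let p (i : Fin 4) : (Fin 4 → ℝ) →L[ℝ] ℝ := ContinuousLinearMap.proj i
    let q : (Fin 4 → ℝ) →L[ℝ] (Fin 2 → ℝ) := ContinuousLinearMap.pi ![p 0, p 1]
    let L : (Fin 4 → ℝ) →L[ℝ] EuclideanSpace ℝ (Fin 2) × ℝ × ℝ :=
      ((EuclideanSpace.equiv (Fin 2) ℝ).symm.toContinuousLinearMap.comp q).prod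
        ((p 0 + p 2).prod (p 1 + p 3))
    have hL : (fun ω => (M ω, X ω, Y ω)) = fun ω => L fun i => ![M₁, M₂, Z₁, Z₂] i ω := by
      subst hM hX hY
      funext ω
      refine Prod.ext ?_ rfl
      ext i
      fin_cases i <;> rfl
    rw [hL]
    exact h.map_fun L
  have hlaw : P = PID.indepLaw e J J := by
    -- The four variables are regrouped by channel, signal with its own noise.
    have hprod : μ.map (fun ω => ((M₁ ω, Z₁ ω), (M₂ ω, Z₂ ω))) =
        ((gaussianReal 0 1).prod (gaussianReal 0 1)).prod
          ((gaussianReal 0 1).prod (gaussianReal 0 1)) := by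
      have h1 : IndepFun M₁ Z₁ μ := hindep.indepFun (i := 0) (j := 2) (by decide)
      have h2 : IndepFun M₂ Z₂ μ := hindep.indepFun (i := 1) (j := 3) (by decide)
      have h12 : IndepFun (fun ω => (M₁ ω, Z₁ ω)) (fun ω => (M₂ ω, Z₂ ω)) μ :=
        hindep.indepFun_prodMk_prodMk₀ (fun i => (hW i).aemeasurable) 0 2 1 3
          (by decide) (by decide) (by decide) (by decide)
      have m1 := hM₁.aemeasurable
      have m2 := hM₂.aemeasurable
      have m3 := hZ₁.aemeasurable
      have m4 := hZ₂.aemeasurable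
      rw [(indepFun_iff_map_prod_eq_prod_map_map (by fun_prop) (by fun_prop)).1 h12,
        (indepFun_iff_map_prod_eq_prod_map_map m1 m3).1 h1,
        (indepFun_iff_map_prod_eq_prod_map_map m2 m4).1 h2,
        hM₁.map_eq, hM₂.map_eq, hZ₁.map_eq, hZ₂.map_eq]
    have m : AEMeasurable (fun ω => ((M₁ ω, Z₁ ω), (M₂ ω, Z₂ ω))) μ :=
      (hM₁.aemeasurable.prodMk hZ₁.aemeasurable).prodMk
        (hM₂.aemeasurable.prodMk hZ₂.aemeasurable)
    have hJ : J.prod J = (((gaussianReal 0 1).prod (gaussianReal 0 1)).prod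
          ((gaussianReal 0 1).prod (gaussianReal 0 1))).map
        fun p : (ℝ × ℝ) × (ℝ × ℝ) => ((p.1.1, p.1.1 + p.1.2), (p.2.1, p.2.1 + p.2.2)) :=
      (PID.map_prod_fst_snd _ _ (f := fun p : ℝ × ℝ => (p.1, p.1 + p.2))
        (g := fun p : ℝ × ℝ => (p.1, p.1 + p.2)) (by fun_prop) (by fun_prop)).symm
    rw [hP, PID.indepLaw, hJ, ← hprod, Measure.map_map (by fun_prop) (by fun_prop),
      AEMeasurable.map_map_of_aemeasurable (by fun_prop) m]
    congr 1
    subst hM hX hY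
    funext ω
    simp only [Function.comp_apply, e, PID.planeEquiv_apply]
  have hIX : PID.mutualInfo (PID.margMX P) = PID.mutualInfo J := by
    rw [hlaw, PID.mutualInfo_margMX_indepLaw]
  have hIY : PID.mutualInfo (PID.margMY P) = PID.mutualInfo J := by
    rw [hlaw, ← PID.margMX_swapXY, PID.swapXY_indepLaw, PID.mutualInfo_margMX_indepLaw]
  have hI : PID.mutualInfo P = PID.mutualInfo J + PID.mutualInfo J := by
    rw [hlaw, PID.mutualInfo_indepLaw]
  have hUX : PID.IsTildeUI P (PID.mutualInfo J) := by
    rw [hlaw]; exact PID.isTildeUI_indepLaw e J J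
  have hUY : PID.IsTildeUI (PID.swapXY P) (PID.mutualInfo J) := by
    rw [hlaw, PID.swapXY_indepLaw]; exact PID.isTildeUI_indepLaw _ J J
  have hpos : 0 < PID.mutualInfo J := PID.mutualInfo_gaussianChannel_pos
  obtain ⟨I, hIJ⟩ := WithTop.ne_top_iff_exists.1 PID.mutualInfo_gaussianChannel_ne_top
  change (I : ℝ≥0∞) = PID.mutualInfo J at hIJ
  rw [← hIJ] at hIX hIY hI hUX hUY hpos
  have hIpos : 0 < I := by exact_mod_cast hpos
  have htilde (t : PID.Decomposition P) (ht : t.IsTilde) :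
      t.uiX = I ∧ t.uiY = I ∧ t.ri = 0 := by
    have hx : t.uiX = I := by exact_mod_cast ht.1.unique hUX
    have hy : t.uiY = I := by exact_mod_cast ht.2.unique hUY
    have h := t.infoX_eq
    rw [hIX, hx] at h
    norm_cast at h
    exact ⟨hx, hy, by simpa using h⟩
  have hmmi (m : PID.Decomposition P) (hm : m.IsMMI) :
      m.ri = I ∧ m.uiX = 0 ∧ m.uiY = 0 := by
    have hr : m.ri = I := by
      rw [PID.Decomposition.IsMMI, hIX, hIY, min_self] at hm
      exact_mod_cast hm
    have hx := m.infoX_eq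
    have hy := m.infoY_eq
    rw [hIX, hr] at hx
    rw [hIY, hr] at hy
    norm_cast at hx hy
    exact ⟨hr, by simpa using hx, by simpa using hy⟩
  -- The total is `2 I`: the unique parts exhaust it, leaving no synergy.
  let t₀ : PID.Decomposition P := ⟨I, I, 0, 0, by simp [hI], by simp [hIX], by simp [hIY]⟩
  have ht₀ : t₀.IsTilde := ⟨hUX, hUY⟩
  -- Redundancy counts `I` only once, so synergy must absorb the other `I`.
  let m₀ : PID.Decomposition P := ⟨0, 0, I, I, by simp [hI], by simp [hIX], by simp [hIY]⟩
  have hm₀ : m₀.IsMMI := by simp [PID.Decomposition.IsMMI, hIX, hIY, m₀]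
  have hne (t : PID.Decomposition P) (ht : t.IsTilde) : ¬ t.IsMMI := fun hm =>
    hIpos.ne' ((hmmi t hm).1.symm.trans (htilde t ht).2.2)
  refine ⟨hgauss, ⟨t₀, ht₀, fun t ht => ?_⟩, ⟨m₀, hm₀, fun m hm => ?_⟩, by rw [hIX, hIY],
    by rwa [hIX], fun t ht => ?_, fun m hm => ?_, hne, fun h => ?_⟩
  · exact PID.Decomposition.ext_of_uiX_uiY (htilde t ht).1 (htilde t ht).2.1
  · exact PID.Decomposition.ext_of_ri (hmmi m hm).1
  · obtain ⟨hx, hy, hr⟩ := htilde t ht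
    rw [hx, hy, hIX, hIY]
    exact ⟨hr, hIpos, hIpos, rfl, rfl, rfl⟩
  · obtain ⟨hr, hx, hy⟩ := hmmi m hm
    rw [hr, hIX, hIY]
    exact ⟨hx, hy, rfl, rfl⟩
  · exact hne t₀ ht₀ (h P (hP ▸ hgauss.isGaussian_map) t₀ ht₀)
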